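/- Fix $\hbar>0$ and a sequence $(q_j)_{j\ge1}$ of positive real numbers, and put $$g_n(x)=(2\pi\hbar)^{-n/2}\exp\Big(-\tfrac1{2\hbar}\sum_{j=1}^n q_jx_j^2\Big),\qquad x\in\mathbb R^n .$$ For a tempered distribution $f$ on $\mathbb R^n$ let $$V_{g_n}f(x,\xi)=\langle f,M_\xi T_xg_n\rangle,\qquad M_\xi T_xg_n(y)=(2\pi\hbar)^{-n/2}e^{\frac i\hbar\xi\cdot y}g_n(y-x),$$ where $\langle f,\varphi\rangle=f(\overline\varphi)$, and $$\|f\|_{M^{\infty,1}_{(g_n)}(\mathbb R^n)}=\int_{\mathbb R^n}\sup_{x\in\mathbb R^n}|V_{g_n}f(x,\xi)|\,d\xi .$$ Let $M^{\infty,1}(\mathbb R^n)$ be the space of all $f$ for which this norm is finite, with this norm; its elements are continuous functions on $\mathbb R^n$. Let $\mathbb R^\infty=\mathbb R^{\mathbb N}$, let $\pi_n:\mathbb R^\infty\to\mathbb R^n$ be the projection on the first $n$ coordinates, and let $\mathcal C_0$ be the set of cylinder functions $f=h\circ\pi_n$ on $\mathbb R^\infty$ with $n\in\mathbb N$ and $h\in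 M^{\infty,1}(\mathbb R^n)$, with the norm $\|f\|_{M^{\infty,1}_{(g)}(\mathbb R^\infty)}=\|h\|_{M^{\infty,1}_{(g_n)}(\mathbb R^n)}$, which does not depend on the representation $f=h\circ\pi_n$. Let $D(L)$ be the closure (completion) of $\mathcal C_0$ in this norm: its elements are the equivalence classes of Cauchy sequences in $\mathcal C_0$, two such sequences $(f_n)$, $(f_n')$ being equivalent if $\|f_n-f_n'\|_{M^{\infty,1}_{(g)}(\mathbb R^\infty)}\to0$. For a function $f_n$ on $\mathbb R^\infty$ and $k\in\mathbb N$ put $$f_n^{(k)}(x_1,\dots,x_k)=f_n(x_1,\dots,x_k,0,0,\dots).$$ **Theorem.** Let $f\in D(L)$ and $k\in\mathbb N$. For every Cauchy sequence $(f_n)$ in $\mathcal C_0$ that represents $f$, the functions $f_n^{(k)}$ belong to $M^{\infty,1}(\mathbb R^k)$ and form a Cauchy sequence in $M^{\infty,1}(\mathbb R^k)$. Moreover there is exactly one $f^{(k)}\in M^{\infty,1}(\mathbb R^k)$ such that, for every representative $(f_n)$ of $f$, $$\lim_{n\to\infty}\|f_n^{(k)}-f^{(k)}\|_{M^{\infty,1}_{(g_k)}(\mathbb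 R^k)}=0 ;$$ that is, the limit exists and does not depend on the representative. -/

import Mathlib

open MeasureTheory Filter Topology
open scoped SchwartzMap ENNReal Nat ContDiff

noncomputable section

/-! ### Phase-space shifts of Schwartz functions and the short-time Fourier transform -/

/-- The function `y ↦ (2πħ)^{-n/2} exp((i/ħ) ξ·y)` by which the modulation operator multiplies. -/
def modulationFactor (ħ : ℝ) {n : ℕ} (ξ : EuclideanSpace ℝ (Fin n)) :
    EuclideanSpace ℝ (Fin n) → ℂ :=
  fun y => (((2 * Real.pi * ħ) ^ (-(n : ℝ) / 2) : ℝ) : ℂ) *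
    Complex.exp (Complex.I * ((inner ℝ ξ y / ħ : ℝ) : ℂ))

theorem hasTemperateGrowth_exp_I :
    Function.HasTemperateGrowth (fun t : ℝ => Complex.exp (Complex.I * (t : ℂ))) := by
  have hd : ∀ t : ℝ, HasDerivAt (fun t : ℝ => Complex.exp (Complex.I * (t : ℂ)))
      (Complex.I * Complex.exp (Complex.I * (t : ℂ))) t := by
    intro t
    have h := ((Complex.ofRealCLM.hasDerivAt (x := t)).const_mul Complex.I).cexp
    simpa [mul_comm] using h
  have hc : ContDiff ℝ ∞ (fun t : ℝ => Complex.exp (Complex.I * (t : ℂ))) :=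
    (contDiff_const.mul Complex.ofRealCLM.contDiff).cexp
  have hit : ∀ m : ℕ, iteratedDeriv m (fun t : ℝ => Complex.exp (Complex.I * (t : ℂ))) =
      fun t : ℝ => Complex.I ^ m * Complex.exp (Complex.I * (t : ℂ)) := by
    intro m
    induction m with
    | zero => simp
    | succ m ih =>
      rw [iteratedDeriv_succ, ih]
      funext t
      rw [((hd t).const_mul (Complex.I ^ m)).deriv]
      ring
  refine ⟨hc, fun m => ⟨0, 1, fun x => ?_⟩⟩
  rw [norm_iteratedFDeriv_eq_norm_iteratedDeriv, hit]
  have : ‖Complex.exp (Complex.I * (x : ℂ))‖ = 1 := by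
    rw [mul_comm]; exact Complex.norm_exp_ofReal_mul_I x
  simp [this]

theorem hasTemperateGrowth_modulationFactor (ħ : ℝ) {n : ℕ} (ξ : EuclideanSpace ℝ (Fin n)) :
    (modulationFactor ħ ξ).HasTemperateGrowth := by
  have h1 : Function.HasTemperateGrowth
      (fun y : EuclideanSpace ℝ (Fin n) => (inner ℝ ξ y / ħ : ℝ)) := by
    have := (ħ⁻¹ • innerSL ℝ ξ).hasTemperateGrowth
    convert this using 2 with y
    simp [div_eq_inv_mul]
  have h2 := hasTemperateGrowth_exp_I.comp h1
  exact (Function.HasTemperateGrowth.const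
    (((2 * Real.pi * ħ) ^ (-(n : ℝ) / 2) : ℝ) : ℂ)).mul h2

/-- The phase-space shift `π(x,ξ) g = M_ξ T_x g`, where `T_x g (y) = g (y - x)` and
`M_ξ g (y) = (2πħ)^{-n/2} exp((i/ħ) ξ·y) g (y)`. -/
def phaseShift (ħ : ℝ) {n : ℕ} (x ξ : EuclideanSpace ℝ (Fin n))
    (g : 𝓢(EuclideanSpace ℝ (Fin n), ℂ)) : 𝓢(EuclideanSpace ℝ (Fin n), ℂ) :=
  SchwartzMap.smulLeftCLM ℂ (modulationFactor ħ ξ) (SchwartzMap.compSubConstCLM ℂ x g)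

theorem phaseShift_apply (ħ : ℝ) {n : ℕ} (x ξ : EuclideanSpace ℝ (Fin n))
    (g : 𝓢(EuclideanSpace ℝ (Fin n), ℂ)) (y : EuclideanSpace ℝ (Fin n)) :
    phaseShift ħ x ξ g y = (((2 * Real.pi * ħ) ^ (-(n : ℝ) / 2) : ℝ) : ℂ) *
      Complex.exp (Complex.I * ((inner ℝ ξ y / ħ : ℝ) : ℂ)) * g (y - x) := by
  rw [phaseShift, SchwartzMap.smulLeftCLM_apply_apply (hasTemperateGrowth_modulationFactor ħ ξ),
    SchwartzMap.compSubConstCLM_apply, modulationFactor, smul_eq_mul]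

/-- The complex conjugate of a Schwartz function. -/
def conjSchwartz {n : ℕ} (ψ : 𝓢(EuclideanSpace ℝ (Fin n), ℂ)) :
    𝓢(EuclideanSpace ℝ (Fin n), ℂ) :=
  SchwartzMap.postcompCLM (𝕜 := ℝ) (Complex.conjCLE : ℂ →L[ℝ] ℂ) ψ

theorem conjSchwartz_apply {n : ℕ} (ψ : 𝓢(EuclideanSpace ℝ (Fin n), ℂ))
    (y : EuclideanSpace ℝ (Fin n)) : conjSchwartz ψ y = (starRingEnd ℂ) (ψ y) := by
  simp [conjSchwartz, SchwartzMap.postcompCLM_apply]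

/-- The short-time Fourier transform `V_g T (x, ξ) = ⟨T, π(x,ξ) g⟩` of a tempered distribution
`T`, where the pairing `⟨T, ψ⟩` is `T (conj ψ)`. -/
def stft (ħ : ℝ) {n : ℕ} (g : 𝓢(EuclideanSpace ℝ (Fin n), ℂ))
    (T : 𝓢'(EuclideanSpace ℝ (Fin n), ℂ)) (x ξ : EuclideanSpace ℝ (Fin n)) : ℂ :=
  T (conjSchwartz (phaseShift ħ x ξ g))

/-! ### The Sjöstrand class `M^{∞,1}(ℝⁿ)` -/

/-- `‖T‖_{M^{∞,1}_{(g)}} = ∫ sup_x |V_g T (x, ξ)| dξ`, as an extended nonnegative number. -/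
def modulationNorm (ħ : ℝ) {n : ℕ} (g : 𝓢(EuclideanSpace ℝ (Fin n), ℂ))
    (T : 𝓢'(EuclideanSpace ℝ (Fin n), ℂ)) : ℝ≥0∞ :=
  ∫⁻ ξ : EuclideanSpace ℝ (Fin n), ⨆ x : EuclideanSpace ℝ (Fin n), ‖stft ħ g T x ξ‖ₑ

/-- The tempered distribution `T` is given by integration against the function `f`. -/
def Represents {n : ℕ} (f : EuclideanSpace ℝ (Fin n) → ℂ)
    (T : 𝓢'(EuclideanSpace ℝ (Fin n), ℂ)) : Prop :=
  ∀ ψ : 𝓢(EuclideanSpace ℝ (Fin n), ℂ),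
    Integrable (fun y => f y * ψ y) ∧ T ψ = ∫ y, f y * ψ y

/-- The space `M^{∞,1}(ℝⁿ)`, described with the window `g`: all tempered distributions of finite
norm. Such distributions are given by continuous functions, and the space is regarded as a space
of functions on `ℝⁿ`: it consists of the continuous functions whose associated tempered
distribution has finite norm. -/
def Sjostrand (ħ : ℝ) {n : ℕ} (g : 𝓢(EuclideanSpace ℝ (Fin n), ℂ)) :
    Set (EuclideanSpace ℝ (Fin n) → ℂ) :=
  {f | Continuous f ∧ ∃ T : 𝓢'(EuclideanSpace ℝ (Fin n), ℂ),
    Represents f T ∧ modulationNorm ħ g T < ⊤}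

/-- The `M^{∞,1}_{(g)}` norm of a function: the norm of the tempered distribution that it
represents (there is at most one; the value is `∞` if there is none). -/
def sjostrandNorm (ħ : ℝ) {n : ℕ} (g : 𝓢(EuclideanSpace ℝ (Fin n), ℂ))
    (f : EuclideanSpace ℝ (Fin n) → ℂ) : ℝ≥0∞ :=
  ⨅ (T : 𝓢'(EuclideanSpace ℝ (Fin n), ℂ)) (_ : Represents f T), modulationNorm ħ g T

/-! ### The Gaussian windows -/

/-- The quadratic exponent `-(1/(2ħ)) ⟨x, Q_n x⟩`, with `Q_n` diagonal with entries `q_j`. -/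
def gaussianExponent (ħ : ℝ) (q : ℕ → ℝ) (n : ℕ) (x : EuclideanSpace ℝ (Fin n)) : ℝ :=
  -(1 / (2 * ħ)) * ∑ j : Fin n, q j * x j ^ 2

theorem hasTemperateGrowth_gaussianExponent (ħ : ℝ) (q : ℕ → ℝ) (n : ℕ) :
    (gaussianExponent ħ q n).HasTemperateGrowth := by
  unfold gaussianExponent
  refine (Function.HasTemperateGrowth.const _).mul (Function.HasTemperateGrowth.sum fun j _ => ?_)
  exact (Function.HasTemperateGrowth.const _).mul
    ((EuclideanSpace.proj (𝕜 := ℝ) j).hasTemperateGrowth.pow 2)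

theorem exists_gaussianExponent_le {ħ : ℝ} (hħ : 0 < ħ) {q : ℕ → ℝ} (hq : ∀ j, 0 < q j) (n : ℕ) :
    ∃ c > 0, ∀ x : EuclideanSpace ℝ (Fin n), gaussianExponent ħ q n x ≤ -c * ‖x‖ ^ 2 := by
  obtain ⟨d, hd, hdq⟩ : ∃ d > 0, ∀ j : Fin n, d ≤ q j := by
    rcases isEmpty_or_nonempty (Fin n) with h | h
    · exact ⟨1, one_pos, fun j => h.elim j⟩
    · obtain ⟨i, hi⟩ := Finite.exists_min (fun j : Fin n => q j)
      exact ⟨q i, hq i, hi⟩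
  refine ⟨1 / (2 * ħ) * d, by positivity, fun x => ?_⟩
  have h1 : d * ‖x‖ ^ 2 ≤ ∑ j : Fin n, q j * x j ^ 2 := by
    rw [EuclideanSpace.real_norm_sq_eq, Finset.mul_sum]
    exact Finset.sum_le_sum fun j _ => mul_le_mul_of_nonneg_right (hdq j) (sq_nonneg _)
  have h2 : (0 : ℝ) ≤ 1 / (2 * ħ) := by positivity
  have h3 := mul_le_mul_of_nonneg_left h1 h2
  unfold gaussianExponent
  linarith

theorem exists_pow_mul_exp_neg_le {c : ℝ} (hc : 0 < c) (m : ℕ) :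
    ∃ C : ℝ, ∀ r : ℝ, 0 ≤ r → (1 + r) ^ m * Real.exp (-c * r ^ 2) ≤ C := by
  refine ⟨Real.exp c * (m ! * (1 / c) ^ m * Real.exp c), fun r hr => ?_⟩
  have h1 : (c * (1 + r)) ^ m / m ! ≤ Real.exp (c * (1 + r)) :=
    Real.pow_div_factorial_le_exp _ (by positivity) m
  have h2 : (1 + r) ^ m ≤ m ! * (1 / c) ^ m * Real.exp (c * (1 + r)) := by
    rw [div_le_iff₀ (by positivity), mul_pow] at h1
    have h3 := mul_le_mul_of_nonneg_left h1 (by positivity : 0 ≤ (1 / c) ^ m)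
    have h4 : (1 / c) ^ m * (c ^ m * (1 + r) ^ m) = (1 + r) ^ m := by
      rw [← mul_assoc, ← mul_pow, one_div_mul_cancel hc.ne', one_pow, one_mul]
    rw [h4] at h3
    linarith
  have h5 : Real.exp (c * (1 + r)) * Real.exp (-c * r ^ 2) ≤ Real.exp c * Real.exp c := by
    rw [← Real.exp_add, ← Real.exp_add]
    apply Real.exp_le_exp.2
    nlinarith [sq_nonneg (r - 1), mul_nonneg hc.le (sq_nonneg (r - 1)),
      mul_nonneg hc.le (sq_nonneg r)]
  calc (1 + r) ^ m * Real.exp (-c * r ^ 2)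
      ≤ (m ! * (1 / c) ^ m * Real.exp (c * (1 + r))) * Real.exp (-c * r ^ 2) :=
        mul_le_mul_of_nonneg_right h2 (Real.exp_pos _).le
    _ = (m ! * (1 / c) ^ m) * (Real.exp (c * (1 + r)) * Real.exp (-c * r ^ 2)) := by ring
    _ ≤ (m ! * (1 / c) ^ m) * (Real.exp c * Real.exp c) :=
        mul_le_mul_of_nonneg_left h5 (by positivity)
    _ = _ := by ring

theorem gaussian_decay {ħ : ℝ} (hħ : 0 < ħ) {q : ℕ → ℝ} (hq : ∀ j, 0 < q j) (n : ℕ) (k m : ℕ) :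
    ∃ C : ℝ, ∀ x : EuclideanSpace ℝ (Fin n), ‖x‖ ^ k *
      ‖iteratedFDeriv ℝ m (fun x => Real.exp (gaussianExponent ħ q n x)) x‖ ≤ C := by
  have hT := hasTemperateGrowth_gaussianExponent ħ q n
  obtain ⟨l, A, hA, hb⟩ := hT.norm_iteratedFDeriv_le_uniform m
  obtain ⟨c, hc, hle⟩ := exists_gaussianExponent_le hħ hq n
  obtain ⟨B, hB⟩ := exists_pow_mul_exp_neg_le hc (k + l * m)
  refine ⟨m ! * (1 + A) ^ m * B, fun x => ?_⟩
  set D : ℝ := (1 + A) * (1 + ‖x‖) ^ l with hD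
  have hD1 : 1 ≤ D :=
    one_le_mul_of_one_le_of_one_le (by linarith) (one_le_pow₀ (by linarith [norm_nonneg x]))
  have key : ‖iteratedFDeriv ℝ m (Real.exp ∘ gaussianExponent ħ q n) x‖ ≤
      m ! * Real.exp (gaussianExponent ħ q n x) * D ^ m := by
    refine norm_iteratedFDeriv_comp_le (N := ∞) Real.contDiff_exp hT.1 (mod_cast le_top) x ?_ ?_
    · intro i _
      rw [norm_iteratedFDeriv_eq_norm_iteratedDeriv, iteratedDeriv_eq_iterate,
        Real.iter_deriv_exp, Real.norm_of_nonneg (Real.exp_pos _).le]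
    · intro i hi him
      calc ‖iteratedFDeriv ℝ i (gaussianExponent ħ q n) x‖ ≤ A * (1 + ‖x‖) ^ l := hb i him x
        _ ≤ D := by rw [hD]; gcongr; linarith
        _ ≤ D ^ i := le_self_pow₀ hD1 (by omega)
  have h0 := norm_nonneg x
  have hexp : Real.exp (gaussianExponent ħ q n x) ≤ Real.exp (-c * ‖x‖ ^ 2) :=
    Real.exp_le_exp.2 (hle x)
  calc ‖x‖ ^ k * ‖iteratedFDeriv ℝ m (fun x => Real.exp (gaussianExponent ħ q n x)) x‖
      ≤ (1 + ‖x‖) ^ k * (m ! * Real.exp (-c * ‖x‖ ^ 2) * D ^ m) := by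
        refine mul_le_mul (pow_le_pow_left₀ h0 (by linarith) k) (key.trans ?_)
          (norm_nonneg _) (by positivity)
        gcongr
    _ = m ! * (1 + A) ^ m * ((1 + ‖x‖) ^ (k + l * m) * Real.exp (-c * ‖x‖ ^ 2)) := by
        rw [hD, mul_pow, ← pow_mul, pow_add]; ring
    _ ≤ m ! * (1 + A) ^ m * B := mul_le_mul_of_nonneg_left (hB _ h0) (by positivity)

/-- The real Gaussian `exp(-(1/(2ħ)) ⟨x, Q_n x⟩)` as a Schwartz function. -/
def realGaussian (ħ : ℝ) (hħ : 0 < ħ) (q : ℕ → ℝ) (hq : ∀ j, 0 < q j) (n : ℕ) :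
    𝓢(EuclideanSpace ℝ (Fin n), ℝ) where
  toFun x := Real.exp (gaussianExponent ħ q n x)
  smooth' := (hasTemperateGrowth_gaussianExponent ħ q n).1.exp
  decay' k m := gaussian_decay hħ hq n k m

/-- The window `g_n (x) = (2πħ)^{-n/2} exp(-(1/(2ħ)) ⟨x, Q_n x⟩)`, where `Q_n` is the diagonal
matrix with entries `q 0, …, q (n-1)`. -/
def gaussianWindow (ħ : ℝ) (hħ : 0 < ħ) (q : ℕ → ℝ) (hq : ∀ j, 0 < q j) (n : ℕ) :
    𝓢(EuclideanSpace ℝ (Fin n), ℂ) :=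
  (((2 * Real.pi * ħ) ^ (-(n : ℝ) / 2) : ℝ) : ℂ) •
    SchwartzMap.postcompCLM (𝕜 := ℝ) Complex.ofRealCLM (realGaussian ħ hħ q hq n)

theorem gaussianWindow_apply (ħ : ℝ) (hħ : 0 < ħ) (q : ℕ → ℝ) (hq : ∀ j, 0 < q j) (n : ℕ)
    (x : EuclideanSpace ℝ (Fin n)) :
    gaussianWindow ħ hħ q hq n x = (((2 * Real.pi * ħ) ^ (-(n : ℝ) / 2) *
      Real.exp (-(1 / (2 * ħ)) * ∑ j : Fin n, q j * x j ^ 2) : ℝ) : ℂ) := by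
  rw [Complex.ofReal_mul]
  rfl

/-! ### Cylinder functions on `ℝ^∞ = ℕ → ℝ` -/

/-- The projection `π_n : ℝ^∞ → ℝⁿ` on the first `n` coordinates. -/
def coordProj (n : ℕ) (x : ℕ → ℝ) : EuclideanSpace ℝ (Fin n) :=
  WithLp.toLp 2 fun j : Fin n => x j

/-- The extension `𝓔_n h (x) = h (π_n x)` of a function on `ℝⁿ` to `ℝ^∞`. -/
def cylExtend (n : ℕ) (h : EuclideanSpace ℝ (Fin n) → ℂ) : (ℕ → ℝ) → ℂ :=
  fun x => h (coordProj n x)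

/-- The inclusion `(x_1, …, x_k) ↦ (x_1, …, x_k, 0, 0, …)` of `ℝ^k` in `ℝ^∞`. -/
def zeroPad (k : ℕ) (x : EuclideanSpace ℝ (Fin k)) : ℕ → ℝ :=
  fun j => if hj : j < k then x ⟨j, hj⟩ else 0

/-- The restriction `f^{(k)} (x_1, …, x_k) = f (x_1, …, x_k, 0, 0, …)`. -/
def cylRestrict (k : ℕ) (f : (ℕ → ℝ) → ℂ) : EuclideanSpace ℝ (Fin k) → ℂ :=
  fun x => f (zeroPad k x)

/-- The cylinder functions `𝓒₀ = ⋃_n 𝓔_n M^{∞,1}(ℝⁿ)`. -/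
def cylinderFunctions (ħ : ℝ) (hħ : 0 < ħ) (q : ℕ → ℝ) (hq : ∀ j, 0 < q j) :
    Set ((ℕ → ℝ) → ℂ) :=
  ⋃ n : ℕ, cylExtend n '' Sjostrand ħ (gaussianWindow ħ hħ q hq n)

/-- The norm on `𝓒₀`: `‖f‖_{M^{∞,1}_{(g)}(ℝ^∞)} = ‖h‖_{M^{∞,1}_{(g_n)}(ℝⁿ)}` for `f = 𝓔_n h` with
`h ∈ M^{∞,1}(ℝⁿ)`. The right-hand side is the same for all representations `f = 𝓔_n h`, so the
infimum below is over a single value (and is `∞` if `f` is not in `𝓒₀`). -/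
def cylNorm (ħ : ℝ) (hħ : 0 < ħ) (q : ℕ → ℝ) (hq : ∀ j, 0 < q j) (f : (ℕ → ℝ) → ℂ) : ℝ≥0∞ :=
  ⨅ (n : ℕ) (h : EuclideanSpace ℝ (Fin n) → ℂ)
    (_ : h ∈ Sjostrand ħ (gaussianWindow ħ hħ q hq n) ∧ f = cylExtend n h),
    sjostrandNorm ħ (gaussianWindow ħ hħ q hq n) h

/-! ### The closure `D(L)` of the cylinder functions -/

/-- Cauchy sequences of cylinder functions for the norm of `M^{∞,1}_{(g)}(ℝ^∞)`. -/
structure CylCauchySeq (ħ : ℝ) (hħ : 0 < ħ) (q : ℕ → ℝ) (hq : ∀ j, 0 < q j) where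
  /-- the terms of the sequence -/
  seq : ℕ → (ℕ → ℝ) → ℂ
  mem : ∀ n, seq n ∈ cylinderFunctions ħ hħ q hq
  cauchy : ∀ ε : ℝ≥0∞, 0 < ε → ∃ N, ∀ m ≥ N, ∀ n ≥ N, cylNorm ħ hħ q hq (seq m - seq n) < ε

/-- Two Cauchy sequences of cylinder functions are equivalent if the norm of their difference
tends to `0`. -/
def CylCauchySeq.Equivalent {ħ : ℝ} {hħ : 0 < ħ} {q : ℕ → ℝ} {hq : ∀ j, 0 < q j}
    (s t : CylCauchySeq ħ hħ q hq) : Prop :=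
  Tendsto (fun n => cylNorm ħ hħ q hq (s.seq n - t.seq n)) atTop (𝓝 0)

/-- The domain `D(L)`: the closure (completion) of the cylinder functions in the norm of
`M^{∞,1}_{(g)}(ℝ^∞)`, whose elements are the equivalence classes of Cauchy sequences of cylinder
functions. -/
def CylClosure (ħ : ℝ) (hħ : 0 < ħ) (q : ℕ → ℝ) (hq : ∀ j, 0 < q j) : Type :=
  Quot (CylCauchySeq.Equivalent (ħ := ħ) (hħ := hħ) (q := q) (hq := hq))

/-- The Cauchy sequence `s` is a representative of `f ∈ D(L)`. -/
def CylCauchySeq.IsRepresentative {ħ : ℝ} {hħ : 0 < ħ} {q : ℕ → ℝ} {hq : ∀ j, 0 < q j}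
    (s : CylCauchySeq ħ hħ q hq) (f : CylClosure ħ hħ q hq) : Prop :=
  Quot.mk _ s = f

end

noncomputable section

open scoped BoundedContinuousFunction

/-! Setting all coordinates after the `k`-th to zero is bounded from the cylinder functions to
`M^{∞,1}(ℝ^k)`, with a constant that depends on `k` but not on the number `n` of variables
(`exists_functionNorm_restrictBCF_le`). Given this bound and the completeness of `M^{∞,1}(ℝ^k)`, the
theorem is the usual extension of a bounded map to a completion.

The bound rests on Fourier inversion: at a point of continuity, an integrable function is at most
`(2πħ)^{-n/2}` times the `L¹` norm of its transform. A Gaussian window takes exactly the value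
`(2πħ)^{-n/2}` at the origin, so the constants cancel. Used in all variables, this shows that the
norm dominates the supremum norm (`enorm_le_functionNorm`). Used only in the variables to be
removed, after factoring the window, it shows that restriction has norm at most 1 when `k ≤ n`
(`functionNorm_restrict_le`). The finitely many `n < k` require an extension by constants, which
costs a finite factor (`functionNorm_extend_le`).

For completeness (`exists_tendsto_functionNorm`), a Cauchy sequence converges uniformly, its
short-time Fourier transforms converge pointwise, and Fatou's lemma gives convergence in norm. -/

/-- `ℝⁿ` with its Euclidean structure. -/
abbrev Euc (n : ℕ) : Type := EuclideanSpace ℝ (Fin n)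

/-- The normalization constant `(2πħ)^{-n/2}`. -/
def normalization (ħ : ℝ) (n : ℕ) : ℝ := (2 * Real.pi * ħ) ^ (-(n : ℝ) / 2)

theorem normalization_pos {ħ : ℝ} (hħ : 0 < ħ) (n : ℕ) : 0 < normalization ħ n := by
  unfold normalization; positivity

theorem normalization_add {ħ : ℝ} (hħ : 0 < ħ) (k m : ℕ) :
    normalization ħ (k + m) = normalization ħ k * normalization ħ m := by
  unfold normalization
  rw [← Real.rpow_add (by positivity)]
  push_cast
  congr 1
  ring

/-- The balance of constants in Fourier inversion: one factor comes from `semiclassicalFourier`, one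
from the inverse transform, and the power is the Jacobian of the rescaling that relates it to
Mathlib's transform. -/
theorem normalization_sq_mul {ħ : ℝ} (hħ : 0 < ħ) (n : ℕ) :
    normalization ħ n * normalization ħ n * (2 * Real.pi * ħ) ^ n = 1 := by
  have h : 0 < 2 * Real.pi * ħ := by positivity
  unfold normalization
  rw [← Real.rpow_natCast, ← Real.rpow_add h, ← Real.rpow_add h]
  ring_nf
  simp

/-! ### The semiclassical Fourier transform -/

/-- The Fourier transform `u ↦ (2πħ)^{-n/2} ∫ u(y) exp(-(i/ħ) ξ·y) dy`. -/
def semiclassicalFourier (ħ : ℝ) {n : ℕ} (u : Euc n → ℂ) (ξ : Euc n) : ℂ :=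
  ∫ y, u y * (starRingEnd ℂ) (modulationFactor ħ ξ y)

theorem conj_modulationFactor (ħ : ℝ) {n : ℕ} (ξ y : Euc n) :
    (starRingEnd ℂ) (modulationFactor ħ ξ y) =
      (normalization ħ n : ℂ) * Complex.exp (((-(inner ℝ ξ y / ħ) : ℝ) : ℂ) * Complex.I) := by
  rw [modulationFactor, map_mul, Complex.conj_ofReal, ← Complex.exp_conj, map_mul,
    Complex.conj_I, Complex.conj_ofReal, normalization]
  congr 2
  push_cast
  ring

theorem norm_conj_modulationFactor {ħ : ℝ} (hħ : 0 < ħ) {n : ℕ} (ξ y : Euc n) :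
    ‖(starRingEnd ℂ) (modulationFactor ħ ξ y)‖ = normalization ħ n := by
  rw [conj_modulationFactor, norm_mul, Complex.norm_exp_ofReal_mul_I, mul_one,
    Complex.norm_of_nonneg (normalization_pos hħ n).le]

theorem continuous_conj_modulationFactor (ħ : ℝ) {n : ℕ} (ξ : Euc n) :
    Continuous fun y : Euc n => (starRingEnd ℂ) (modulationFactor ħ ξ y) := by
  simp_rw [conj_modulationFactor]
  fun_prop

theorem continuous_conj_modulationFactor_left (ħ : ℝ) {n : ℕ} (y : Euc n) :
    Continuous fun ξ : Euc n => (starRingEnd ℂ) (modulationFactor ħ ξ y) := by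
  simp_rw [conj_modulationFactor]
  fun_prop

theorem integrable_mul_conj_modulationFactor {ħ : ℝ} (hħ : 0 < ħ) {n : ℕ} {u : Euc n → ℂ}
    (hu : Integrable u) (ξ : Euc n) :
    Integrable fun y => u y * (starRingEnd ℂ) (modulationFactor ħ ξ y) :=
  hu.mul_bdd (c := normalization ħ n)
    (continuous_conj_modulationFactor ħ ξ).aestronglyMeasurable
    (ae_of_all _ fun y => (norm_conj_modulationFactor hħ ξ y).le)

theorem continuous_semiclassicalFourier {ħ : ℝ} (hħ : 0 < ħ) {n : ℕ} {u : Euc n → ℂ}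
    (hu : Integrable u) : Continuous (semiclassicalFourier ħ u) := by
  refine continuous_of_dominated (bound := fun y => ‖u y‖ * normalization ħ n)
    (fun ξ => (integrable_mul_conj_modulationFactor hħ hu ξ).aestronglyMeasurable)
    (fun ξ => ae_of_all _ fun y => ?_) (hu.norm.mul_const _) (ae_of_all _ fun y => ?_)
  · rw [norm_mul, norm_conj_modulationFactor hħ]
  · exact continuous_const.mul (continuous_conj_modulationFactor_left ħ y)

theorem semiclassicalFourier_eq {ħ : ℝ} (hħ : 0 < ħ) {n : ℕ} (u : Euc n → ℂ) (ξ : Euc n) :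
    semiclassicalFourier ħ u ξ =
      (normalization ħ n : ℂ) * FourierTransform.fourier u ((2 * Real.pi * ħ)⁻¹ • ξ) := by
  rw [Real.fourier_eq', ← integral_const_mul, semiclassicalFourier]
  congr 1 with y
  rw [conj_modulationFactor, smul_eq_mul, inner_smul_right, real_inner_comm ξ y]
  have : -2 * Real.pi * ((2 * Real.pi * ħ)⁻¹ * inner ℝ ξ y) = -(inner ℝ ξ y / ħ) := by
    field_simp
  rw [this]
  ring

theorem lintegral_comp_inv_smul {r : ℝ} (hr : 0 < r) {n : ℕ} {F : Euc n → ℝ≥0∞}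
    (hF : Measurable F) :
    ∫⁻ ξ, F (r⁻¹ • ξ) = ENNReal.ofReal (r ^ n) * ∫⁻ ξ, F ξ := by
  have h := Measure.map_addHaar_smul (volume : Measure (Euc n)) (inv_ne_zero hr.ne')
  rw [finrank_euclideanSpace_fin, inv_pow, inv_inv, abs_of_pos (pow_pos hr n)] at h
  rw [← lintegral_map hF (by fun_prop : Measurable fun ξ : Euc n => r⁻¹ • ξ), h,
    lintegral_smul_measure, smul_eq_mul]

/-- Nothing is to be shown if the right side is infinite; otherwise the transform is integrable and
pointwise Fourier inversion applies. -/
theorem enorm_le_lintegral_fourier {n : ℕ} {u : Euc n → ℂ} (hu : Integrable u)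
    {y : Euc n} (hy : ContinuousAt u y) :
    ‖u y‖ₑ ≤ ∫⁻ ξ, ‖FourierTransform.fourier u ξ‖ₑ := by
  by_cases h : ∫⁻ ξ, ‖FourierTransform.fourier u ξ‖ₑ = ⊤
  · rw [h]; exact le_top
  have hc : Continuous (FourierTransform.fourier u) :=
    VectorFourier.fourierIntegral_continuous Real.continuous_fourierChar
      (by exact continuous_inner) hu
  have hi : Integrable (FourierTransform.fourier u) :=
    ⟨hc.aestronglyMeasurable, lt_top_iff_ne_top.2 h⟩
  rw [← hu.fourierInv_fourier_eq hi hy, Real.fourierInv_eq']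
  refine (enorm_integral_le_lintegral_enorm _).trans (lintegral_mono fun ξ => ?_)
  rw [enorm_smul, ← ofReal_norm, Complex.norm_exp_ofReal_mul_I, ENNReal.ofReal_one, one_mul]

/-- The value of an integrable function at a point of continuity is bounded by the `L¹` norm of
its Fourier transform. -/
theorem enorm_le_lintegral_semiclassicalFourier {ħ : ℝ} (hħ : 0 < ħ) {n : ℕ} {u : Euc n → ℂ}
    (hu : Integrable u) {y : Euc n} (hy : ContinuousAt u y) :
    ‖u y‖ₑ ≤ ENNReal.ofReal (normalization ħ n) * ∫⁻ ξ, ‖semiclassicalFourier ħ u ξ‖ₑ := by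
  have hc := normalization_pos hħ n
  have hcont : Continuous (FourierTransform.fourier u) :=
    VectorFourier.fourierIntegral_continuous Real.continuous_fourierChar
      (by exact continuous_inner) hu
  have e : ∫⁻ ξ, ‖semiclassicalFourier ħ u ξ‖ₑ = ENNReal.ofReal (normalization ħ n) *
      (ENNReal.ofReal ((2 * Real.pi * ħ) ^ n) * ∫⁻ ξ, ‖FourierTransform.fourier u ξ‖ₑ) := by
    rw [← lintegral_comp_inv_smul (by positivity) hcont.enorm.measurable,
      ← lintegral_const_mul' _ _ ENNReal.ofReal_ne_top]
    congr 1 with ξ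
    rw [semiclassicalFourier_eq hħ, enorm_mul, ← ofReal_norm (normalization ħ n : ℂ),
      Complex.norm_of_nonneg hc.le]
  rw [e, ← mul_assoc, ← mul_assoc, ← ENNReal.ofReal_mul hc.le,
    ← ENNReal.ofReal_mul (by positivity), normalization_sq_mul hħ, ENNReal.ofReal_one, one_mul]
  exact enorm_le_lintegral_fourier hu hy

/-! ### Splitting `ℝ^{k+m}` -/

/-- The vector of `ℝ^{k+m}` with components `a ∈ ℝ^k` and `b ∈ ℝ^m`. -/
def joinEuc {k m : ℕ} (p : Euc k × Euc m) : Euc (k + m) :=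
  (EuclideanSpace.finAddEquivProd (𝕜 := ℝ)).symm p

theorem joinEuc_castAdd {k m : ℕ} (p : Euc k × Euc m) (i : Fin k) :
    joinEuc p (Fin.castAdd m i) = p.1 i := by
  have h := congrArg (fun z => z.1 i)
    ((EuclideanSpace.finAddEquivProd (𝕜 := ℝ) (n := k) (m := m)).apply_symm_apply p)
  exact h

theorem joinEuc_natAdd {k m : ℕ} (p : Euc k × Euc m) (i : Fin m) :
    joinEuc p (Fin.natAdd k i) = p.2 i := by
  have h := congrArg (fun z => z.2 i)
    ((EuclideanSpace.finAddEquivProd (𝕜 := ℝ) (n := k) (m := m)).apply_symm_apply p)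
  exact h

theorem continuous_joinEuc {k m : ℕ} : Continuous (joinEuc (k := k) (m := m)) :=
  (EuclideanSpace.finAddEquivProd (𝕜 := ℝ)).symm.continuous

theorem joinEuc_surjective {k m : ℕ} : Function.Surjective (joinEuc (k := k) (m := m)) :=
  (EuclideanSpace.finAddEquivProd (𝕜 := ℝ)).symm.surjective

theorem joinEuc_sub {k m : ℕ} (p p' : Euc k × Euc m) :
    joinEuc p - joinEuc p' = joinEuc (p - p') :=
  ((EuclideanSpace.finAddEquivProd (𝕜 := ℝ)).symm.map_sub p p').symm

theorem inner_joinEuc {k m : ℕ} (p p' : Euc k × Euc m) :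
    inner ℝ (joinEuc p) (joinEuc p') = inner ℝ p.1 p'.1 + inner ℝ p.2 p'.2 := by
  simp only [PiLp.inner_apply, Fin.sum_univ_add, joinEuc_castAdd, joinEuc_natAdd]

theorem measurableEmbedding_joinEuc {k m : ℕ} :
    MeasurableEmbedding (joinEuc (k := k) (m := m)) :=
  (EuclideanSpace.finAddEquivProd (𝕜 := ℝ) (n := k)
    (m := m)).symm.toHomeomorph.measurableEmbedding

theorem measurePreserving_joinEuc {k m : ℕ} : MeasurePreserving (joinEuc (k := k) (m := m)) :=
  -- `joinEuc` unfolds to this composite: from the product to its `L²` version, which preserves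
  -- volume, followed by two linear isometries.
  ((LinearIsometryEquiv.measurePreserving
      (LinearIsometryEquiv.piLpCongrLeft 2 ℝ ℝ finSumFinEquiv.symm).symm).comp
    (LinearIsometryEquiv.measurePreserving (E := WithLp 2 (Euc k × Euc m))
      (F := EuclideanSpace ℝ (Fin k ⊕ Fin m))
      (PiLp.sumPiLpEquivProdLpPiLp 2 (fun _ => ℝ)).symm)).comp
    (WithLp.volume_preserving_toLp (Euc k) (Euc m))

theorem conj_modulationFactor_joinEuc {ħ : ℝ} (hħ : 0 < ħ) {k m : ℕ} (p p' : Euc k × Euc m) :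
    (starRingEnd ℂ) (modulationFactor ħ (joinEuc p) (joinEuc p')) =
      (starRingEnd ℂ) (modulationFactor ħ p.1 p'.1) *
        (starRingEnd ℂ) (modulationFactor ħ p.2 p'.2) := by
  simp only [conj_modulationFactor, inner_joinEuc, normalization_add hħ]
  rw [add_div, neg_add, Complex.ofReal_add, add_mul, Complex.exp_add]
  push_cast
  ring

/-- Fubini, since the kernel factors. The variable `a` is integrated first, so that the inner
integral can become a short-time Fourier transform on `ℝ^k` with `b` as a parameter. -/
theorem semiclassicalFourier_joinEuc {ħ : ℝ} (hħ : 0 < ħ) {k m : ℕ} {u : Euc (k + m) → ℂ}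
    (hu : Integrable u) (ξ : Euc k × Euc m) :
    semiclassicalFourier ħ u (joinEuc ξ) =
      semiclassicalFourier ħ
        (fun b => semiclassicalFourier ħ (fun a => u (joinEuc (a, b))) ξ.1) ξ.2 := by
  have hi := (measurePreserving_joinEuc (k := k) (m := m)).integrable_comp_of_integrable
    (integrable_mul_conj_modulationFactor hħ hu (joinEuc ξ))
  rw [semiclassicalFourier,
    ← measurePreserving_joinEuc.integral_comp measurableEmbedding_joinEuc]
  rw [Measure.volume_eq_prod] at hi ⊢
  refine (integral_prod_symm _ hi).trans ?_
  rw [semiclassicalFourier]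
  congr 1 with b
  rw [semiclassicalFourier, ← integral_mul_const]
  congr 1 with a
  rw [Function.comp_apply, conj_modulationFactor_joinEuc hħ, mul_assoc]

/-! ### The short-time Fourier transform of a function -/

/-- The short-time Fourier transform of a function `f` with window `g`. -/
def functionSTFT (ħ : ℝ) {n : ℕ} (g : 𝓢(Euc n, ℂ)) (f : Euc n → ℂ) (x ξ : Euc n) : ℂ :=
  semiclassicalFourier ħ (fun y => f y * (starRingEnd ℂ) (g (y - x))) ξ

/-- The `M^{∞,1}` norm of a function, computed from the integral form of its short-time Fourier
transform. -/
def functionNorm (ħ : ℝ) {n : ℕ} (g : 𝓢(Euc n, ℂ)) (f : Euc n → ℂ) : ℝ≥0∞ :=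
  ∫⁻ ξ, ⨆ x, ‖functionSTFT ħ g f x ξ‖ₑ

theorem conjSchwartz_phaseShift_apply (ħ : ℝ) {n : ℕ} (g : 𝓢(Euc n, ℂ)) (x ξ y : Euc n) :
    conjSchwartz (phaseShift ħ x ξ g) y =
      (starRingEnd ℂ) (g (y - x)) * (starRingEnd ℂ) (modulationFactor ħ ξ y) := by
  rw [conjSchwartz_apply, phaseShift_apply, map_mul, mul_comm, modulationFactor]

theorem Represents.stft_eq {ħ : ℝ} {n : ℕ} (g : 𝓢(Euc n, ℂ)) {f : Euc n → ℂ}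
    {T : 𝓢'(Euc n, ℂ)} (h : Represents f T) (x ξ : Euc n) :
    stft ħ g T x ξ = functionSTFT ħ g f x ξ := by
  rw [stft, (h _).2, functionSTFT, semiclassicalFourier]
  congr 1 with y
  rw [conjSchwartz_phaseShift_apply, mul_assoc]

/-- The right side does not involve `T`, so the infimum defining `sjostrandNorm` runs over a single
value. -/
theorem Represents.modulationNorm_eq {ħ : ℝ} {n : ℕ} (g : 𝓢(Euc n, ℂ)) {f : Euc n → ℂ}
    {T : 𝓢'(Euc n, ℂ)} (h : Represents f T) :
    modulationNorm ħ g T = functionNorm ħ g f := by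
  simp only [modulationNorm, functionNorm, h.stft_eq]

theorem Represents.integrable_mul_window {n : ℕ} (g : 𝓢(Euc n, ℂ)) {f : Euc n → ℂ}
    {T : 𝓢'(Euc n, ℂ)} (h : Represents f T) (x : Euc n) :
    Integrable fun y => f y * (starRingEnd ℂ) (g (y - x)) := by
  have := (h (conjSchwartz (SchwartzMap.compSubConstCLM ℂ x g))).1
  simpa only [conjSchwartz_apply, SchwartzMap.compSubConstCLM_apply] using this

theorem integrable_window {n : ℕ} (g : 𝓢(Euc n, ℂ)) (x : Euc n) :
    Integrable fun y => (starRingEnd ℂ) (g (y - x)) := by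
  refine ((conjSchwartz (SchwartzMap.compSubConstCLM ℂ x g)).integrable (μ := volume)).congr
    (ae_of_all _ fun y => ?_)
  simp only [conjSchwartz_apply, SchwartzMap.compSubConstCLM_apply]

theorem integrable_mul_window {n : ℕ} (g : 𝓢(Euc n, ℂ)) (f : Euc n →ᵇ ℂ) (x : Euc n) :
    Integrable fun y => f y * (starRingEnd ℂ) (g (y - x)) :=
  (integrable_window g x).bdd_mul (c := ‖f‖) f.continuous.aestronglyMeasurable
    (ae_of_all _ f.norm_coe_le_norm)

theorem exists_represents {n : ℕ} (f : Euc n →ᵇ ℂ) : ∃ T : 𝓢'(Euc n, ℂ), Represents f T := by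
  have hf : MemLp f ⊤ (volume : Measure (Euc n)) :=
    memLp_top_of_bound f.continuous.aestronglyMeasurable ‖f‖ (ae_of_all _ f.norm_coe_le_norm)
  refine ⟨Lp.toTemperedDistribution (hf.toLp f), fun ψ => ⟨ψ.integrable.bdd_mul (c := ‖f‖)
    f.continuous.aestronglyMeasurable (ae_of_all _ f.norm_coe_le_norm), ?_⟩⟩
  rw [Lp.toTemperedDistribution_apply]
  refine integral_congr_ae ?_
  filter_upwards [hf.coeFn_toLp] with y hy
  rw [hy, smul_eq_mul, mul_comm]

/-- Boundedness provides a representing distribution; without one the left side is `∞`, whatever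
`functionNorm` is. Hence the use of `→ᵇ` in the estimates. -/
theorem sjostrandNorm_coe (ħ : ℝ) {n : ℕ} (g : 𝓢(Euc n, ℂ)) (f : Euc n →ᵇ ℂ) :
    sjostrandNorm ħ g f = functionNorm ħ g f := by
  obtain ⟨T, hT⟩ := exists_represents f
  refine le_antisymm ((iInf₂_le T hT).trans_eq (hT.modulationNorm_eq g)) ?_
  exact le_iInf₂ fun S hS => (hS.modulationNorm_eq g).ge

theorem coe_mem_sjostrand {ħ : ℝ} {n : ℕ} {g : 𝓢(Euc n, ℂ)} {f : Euc n →ᵇ ℂ}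
    (h : functionNorm ħ g f < ⊤) : ⇑f ∈ Sjostrand ħ g := by
  obtain ⟨T, hT⟩ := exists_represents f
  exact ⟨f.continuous, T, hT, by rwa [hT.modulationNorm_eq]⟩

theorem functionSTFT_add {ħ : ℝ} (hħ : 0 < ħ) {n : ℕ} (g : 𝓢(Euc n, ℂ)) (f₁ f₂ : Euc n →ᵇ ℂ)
    (x ξ : Euc n) : functionSTFT ħ g (f₁ + f₂) x ξ =
      functionSTFT ħ g f₁ x ξ + functionSTFT ħ g f₂ x ξ := by
  unfold functionSTFT semiclassicalFourier
  rw [← integral_add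
    (integrable_mul_conj_modulationFactor hħ (integrable_mul_window g f₁ x) ξ)
    (integrable_mul_conj_modulationFactor hħ (integrable_mul_window g f₂ x) ξ)]
  congr 1 with y
  simp only [Pi.add_apply]
  ring

theorem functionSTFT_neg (ħ : ℝ) {n : ℕ} (g : 𝓢(Euc n, ℂ)) (f : Euc n → ℂ)
    (x ξ : Euc n) : functionSTFT ħ g (-f) x ξ = -functionSTFT ħ g f x ξ := by
  unfold functionSTFT semiclassicalFourier
  rw [← integral_neg]
  congr 1 with y
  simp

theorem functionNorm_neg (ħ : ℝ) {n : ℕ} (g : 𝓢(Euc n, ℂ)) (f : Euc n → ℂ) :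
    functionNorm ħ g (-f) = functionNorm ħ g f := by
  simp only [functionNorm, functionSTFT_neg, enorm_neg]

/-- The supremum is over an uncountable family, but a supremum of continuous functions is lower
semicontinuous. -/
theorem measurable_iSup_functionSTFT {ħ : ℝ} (hħ : 0 < ħ) {n : ℕ} (g : 𝓢(Euc n, ℂ))
    (f : Euc n →ᵇ ℂ) : Measurable fun ξ => ⨆ x, ‖functionSTFT ħ g f x ξ‖ₑ :=
  (lowerSemicontinuous_iSup fun x => (continuous_semiclassicalFourier hħ
    (integrable_mul_window g f x)).enorm.lowerSemicontinuous).measurable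

theorem functionNorm_add_le {ħ : ℝ} (hħ : 0 < ħ) {n : ℕ} (g : 𝓢(Euc n, ℂ))
    (f₁ f₂ : Euc n →ᵇ ℂ) :
    functionNorm ħ g (f₁ + f₂) ≤ functionNorm ħ g f₁ + functionNorm ħ g f₂ := by
  unfold functionNorm
  rw [← lintegral_add_left (measurable_iSup_functionSTFT hħ g f₁)]
  refine lintegral_mono fun ξ => iSup_le fun x => ?_
  rw [functionSTFT_add hħ]
  exact (enorm_add_le _ _).trans (add_le_add
    (le_iSup (fun x => ‖functionSTFT ħ g f₁ x ξ‖ₑ) x)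
    (le_iSup (fun x => ‖functionSTFT ħ g f₂ x ξ‖ₑ) x))

theorem functionNorm_sub_le {ħ : ℝ} (hħ : 0 < ħ) {n : ℕ} (g : 𝓢(Euc n, ℂ))
    (f₁ f₂ f₃ : Euc n →ᵇ ℂ) : functionNorm ħ g ⇑(f₁ - f₃) ≤
      functionNorm ħ g ⇑(f₁ - f₂) + functionNorm ħ g ⇑(f₂ - f₃) := by
  have h := functionNorm_add_le hħ g (f₁ - f₂) (f₂ - f₃)
  rwa [← BoundedContinuousFunction.coe_add, sub_add_sub_cancel] at h

theorem functionNorm_sub_comm (ħ : ℝ) {n : ℕ} (g : 𝓢(Euc n, ℂ)) (f₁ f₂ : Euc n →ᵇ ℂ) :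
    functionNorm ħ g ⇑(f₁ - f₂) = functionNorm ħ g ⇑(f₂ - f₁) := by
  rw [← functionNorm_neg, ← BoundedContinuousFunction.coe_neg, neg_sub]

/-! ### Gaussian windows: the norm dominates the supremum norm -/

theorem gaussianWindow_eq (ħ : ℝ) (hħ : 0 < ħ) (q : ℕ → ℝ) (hq : ∀ j, 0 < q j) (n : ℕ)
    (x : Euc n) : gaussianWindow ħ hħ q hq n x =
      ((normalization ħ n * Real.exp (gaussianExponent ħ q n x) : ℝ) : ℂ) :=
  gaussianWindow_apply ħ hħ q hq n x

theorem conj_gaussianWindow (ħ : ℝ) (hħ : 0 < ħ) (q : ℕ → ℝ) (hq : ∀ j, 0 < q j) (n : ℕ)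
    (x : Euc n) : (starRingEnd ℂ) (gaussianWindow ħ hħ q hq n x) =
      gaussianWindow ħ hħ q hq n x := by
  rw [gaussianWindow_eq, Complex.conj_ofReal]

theorem gaussianWindow_zero (ħ : ℝ) (hħ : 0 < ħ) (q : ℕ → ℝ) (hq : ∀ j, 0 < q j) (n : ℕ) :
    gaussianWindow ħ hħ q hq n 0 = (normalization ħ n : ℂ) := by
  simp [gaussianWindow_eq, gaussianExponent]

theorem enorm_normalization {ħ : ℝ} (hħ : 0 < ħ) (n : ℕ) :
    ‖(normalization ħ n : ℂ)‖ₑ = ENNReal.ofReal (normalization ħ n) := by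
  rw [← ofReal_norm, Complex.norm_of_nonneg (normalization_pos hħ n).le]

/-- Centre the window at `y` itself: Fourier inversion at `y` recovers `f y` times the value of the
window at `0`, and that value cancels the inversion constant. -/
theorem enorm_le_functionNorm {ħ : ℝ} {hħ : 0 < ħ} {q : ℕ → ℝ} {hq : ∀ j, 0 < q j} {n : ℕ}
    {f : Euc n → ℂ} (hf : Continuous f)
    (hi : ∀ x, Integrable fun y => f y * (starRingEnd ℂ) (gaussianWindow ħ hħ q hq n (y - x)))
    (y : Euc n) : ‖f y‖ₑ ≤ functionNorm ħ (gaussianWindow ħ hħ q hq n) f := by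
  set g := gaussianWindow ħ hħ q hq n with hg
  have hc : Continuous fun z => f z * (starRingEnd ℂ) (g (z - y)) :=
    hf.mul (Complex.continuous_conj.comp (g.continuous.comp (continuous_sub_right y)))
  have h := enorm_le_lintegral_semiclassicalFourier hħ (hi y) (y := y) hc.continuousAt
  rw [sub_self, hg, conj_gaussianWindow, gaussianWindow_zero, enorm_mul, enorm_normalization hħ,
    mul_comm, ENNReal.mul_le_mul_iff_right
      (ENNReal.ofReal_pos.2 (normalization_pos hħ n)).ne' ENNReal.ofReal_ne_top] at h
  exact h.trans (lintegral_mono fun ξ => le_iSup (fun x => ‖functionSTFT ħ g f x ξ‖ₑ) y)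

theorem exists_boundedContinuousFunction_of_mem_sjostrand {ħ : ℝ} {hħ : 0 < ħ} {q : ℕ → ℝ}
    {hq : ∀ j, 0 < q j} {n : ℕ} {f : Euc n → ℂ}
    (hf : f ∈ Sjostrand ħ (gaussianWindow ħ hħ q hq n)) :
    ∃ F : Euc n →ᵇ ℂ, ⇑F = f ∧ functionNorm ħ (gaussianWindow ħ hħ q hq n) F < ⊤ := by
  obtain ⟨hc, T, hT, hfin⟩ := hf
  rw [hT.modulationNorm_eq] at hfin
  refine ⟨BoundedContinuousFunction.ofNormedAddCommGroup f hc
    (functionNorm ħ (gaussianWindow ħ hħ q hq n) f).toReal fun y => ?_, rfl, hfin⟩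
  rw [← toReal_enorm]
  exact ENNReal.toReal_mono hfin.ne
    (enorm_le_functionNorm hc (fun x => hT.integrable_mul_window _ x) y)

/-! ### Completeness -/

theorem functionSTFT_sub {ħ : ℝ} (hħ : 0 < ħ) {n : ℕ} (g : 𝓢(Euc n, ℂ)) (f₁ f₂ : Euc n →ᵇ ℂ)
    (x ξ : Euc n) : functionSTFT ħ g ⇑(f₁ - f₂) x ξ =
      functionSTFT ħ g f₁ x ξ - functionSTFT ħ g f₂ x ξ := by
  rw [sub_eq_add_neg, BoundedContinuousFunction.coe_add, functionSTFT_add hħ,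
    BoundedContinuousFunction.coe_neg, functionSTFT_neg, sub_eq_add_neg]

theorem norm_functionSTFT_le {ħ : ℝ} (hħ : 0 < ħ) {n : ℕ} (g : 𝓢(Euc n, ℂ)) (f : Euc n →ᵇ ℂ)
    (x ξ : Euc n) : ‖functionSTFT ħ g f x ξ‖ ≤
      ‖f‖ * ∫ y, ‖(starRingEnd ℂ) (g (y - x))‖ * normalization ħ n := by
  rw [← integral_const_mul]
  refine norm_integral_le_of_norm_le (((integrable_window g x).norm.mul_const _).const_mul _)
    (ae_of_all _ fun y => ?_)
  rw [norm_mul, norm_mul, norm_conj_modulationFactor hħ, mul_assoc]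
  exact mul_le_mul_of_nonneg_right (f.norm_coe_le_norm y)
    (mul_nonneg (norm_nonneg _) (normalization_pos hħ n).le)

/-- Uniform convergence suffices because the window is integrable. -/
theorem tendsto_functionSTFT {ħ : ℝ} (hħ : 0 < ħ) {n : ℕ} (g : 𝓢(Euc n, ℂ))
    {s : ℕ → Euc n →ᵇ ℂ} {F : Euc n →ᵇ ℂ} (hs : Tendsto s atTop (𝓝 F)) (x ξ : Euc n) :
    Tendsto (fun j => functionSTFT ħ g (s j) x ξ) atTop (𝓝 (functionSTFT ħ g F x ξ)) := by
  rw [tendsto_iff_norm_sub_tendsto_zero] at hs ⊢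
  have h := hs.mul_const (∫ y, ‖(starRingEnd ℂ) (g (y - x))‖ * normalization ħ n)
  rw [zero_mul] at h
  refine squeeze_zero (fun _ => norm_nonneg _) (fun j => ?_) h
  rw [← functionSTFT_sub hħ]
  exact norm_functionSTFT_le hħ g _ x ξ

/-- Fatou's lemma, since the pointwise limit of the transforms is at most the lower limit of their
suprema over `x`. -/
theorem functionNorm_le_liminf {ħ : ℝ} (hħ : 0 < ħ) {n : ℕ} (g : 𝓢(Euc n, ℂ))
    {s : ℕ → Euc n →ᵇ ℂ} {F : Euc n →ᵇ ℂ} (hs : Tendsto s atTop (𝓝 F)) :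
    functionNorm ħ g F ≤ liminf (fun j => functionNorm ħ g (s j)) atTop := by
  refine le_trans (lintegral_mono fun ξ => iSup_le fun x => ?_)
    (lintegral_liminf_le fun j => measurable_iSup_functionSTFT hħ g (s j))
  rw [← (tendsto_functionSTFT hħ g hs x ξ).enorm.liminf_eq]
  exact liminf_le_liminf (Eventually.of_forall fun j =>
    le_iSup (fun x => ‖functionSTFT ħ g (s j) x ξ‖ₑ) x)

/-- The space `M^{∞,1}(ℝⁿ)` with a Gaussian window is complete. -/
theorem exists_tendsto_functionNorm {ħ : ℝ} {hħ : 0 < ħ} {q : ℕ → ℝ} {hq : ∀ j, 0 < q j} {n : ℕ}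
    {s : ℕ → Euc n →ᵇ ℂ} (hfin : ∀ i, functionNorm ħ (gaussianWindow ħ hħ q hq n) (s i) < ⊤)
    (hs : ∀ ε : ℝ≥0∞, 0 < ε → ∃ N, ∀ i ≥ N, ∀ j ≥ N,
      functionNorm ħ (gaussianWindow ħ hħ q hq n) ⇑(s i - s j) < ε) :
    ∃ F : Euc n →ᵇ ℂ, functionNorm ħ (gaussianWindow ħ hħ q hq n) F < ⊤ ∧
      Tendsto (fun i => functionNorm ħ (gaussianWindow ħ hħ q hq n) ⇑(s i - F)) atTop (𝓝 0) := by
  set g := gaussianWindow ħ hħ q hq n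
  have hcau : CauchySeq s := by
    rw [Metric.cauchySeq_iff]
    intro ε hε
    -- Half of `ε`, because pointwise bounds give only a non-strict bound on the supremum norm.
    obtain ⟨N, hN⟩ := hs (ENNReal.ofReal (ε / 2)) (by simpa using hε)
    refine ⟨N, fun i hi j hj => lt_of_le_of_lt ?_ (half_lt_self hε)⟩
    rw [dist_eq_norm, BoundedContinuousFunction.norm_le (half_pos hε).le]
    intro y
    have h1 := (enorm_le_functionNorm (s i - s j).continuous
      (integrable_mul_window _ (s i - s j)) y).trans (hN i hi j hj).le
    rw [← ofReal_norm] at h1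
    exact (ENNReal.ofReal_le_ofReal_iff (half_pos hε).le).1 h1
  obtain ⟨F, hF⟩ := cauchySeq_tendsto_of_complete hcau
  have hlim : ∀ ε : ℝ≥0∞, 0 < ε → ∃ N, ∀ i ≥ N, functionNorm ħ g ⇑(s i - F) ≤ ε := by
    intro ε hε
    obtain ⟨N, hN⟩ := hs ε hε
    -- Lower semicontinuity along `s i - s j` with `i` fixed and `j → ∞`.
    refine ⟨N, fun i hi => (functionNorm_le_liminf hħ g (tendsto_const_nhds.sub hF)).trans ?_⟩
    refine (liminf_le_limsup).trans (limsup_le_of_le (h := ?_))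
    filter_upwards [eventually_ge_atTop N] with j hj using (hN i hi j hj).le
  refine ⟨F, ?_, ENNReal.tendsto_atTop_zero.2 hlim⟩
  obtain ⟨N, hN⟩ := hlim 1 one_pos
  have h1 := functionNorm_sub_le hħ g F (s N) 0
  rw [sub_zero, sub_zero, functionNorm_sub_comm] at h1
  exact h1.trans_lt (ENNReal.add_lt_top.2 ⟨(hN N le_rfl).trans_lt ENNReal.one_lt_top, hfin N⟩)

/-! ### Restriction to and extension from the first coordinates -/

theorem semiclassicalFourier_const_mul (ħ : ℝ) {n : ℕ} (c : ℂ) (u : Euc n → ℂ) (ξ : Euc n) :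
    semiclassicalFourier ħ (fun y => c * u y) ξ = c * semiclassicalFourier ħ u ξ := by
  simp only [semiclassicalFourier, mul_assoc, integral_const_mul]

theorem semiclassicalFourier_mul_const (ħ : ℝ) {n : ℕ} (c : ℂ) (u : Euc n → ℂ) (ξ : Euc n) :
    semiclassicalFourier ħ (fun y => u y * c) ξ = semiclassicalFourier ħ u ξ * c := by
  simp only [mul_comm _ c, semiclassicalFourier_const_mul]

theorem norm_semiclassicalFourier_comp_sub {ħ : ℝ} {n : ℕ} (u : Euc n → ℂ) (x ξ : Euc n) :
    ‖semiclassicalFourier ħ (fun y => u (y - x)) ξ‖ = ‖semiclassicalFourier ħ u ξ‖ := by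
  have h : semiclassicalFourier ħ (fun y => u (y - x)) ξ =
      semiclassicalFourier ħ u ξ *
        Complex.exp (((-(inner ℝ ξ x / ħ) : ℝ) : ℂ) * Complex.I) := by
    unfold semiclassicalFourier
    rw [← integral_mul_const, ← integral_add_right_eq_self _ x]
    congr 1 with y
    beta_reduce
    rw [conj_modulationFactor, conj_modulationFactor, add_sub_cancel_right, mul_assoc, mul_assoc,
      ← Complex.exp_add, ← add_mul, ← Complex.ofReal_add, inner_add_right, add_div, neg_add]
  rw [h, norm_mul, Complex.norm_exp_ofReal_mul_I, mul_one]

theorem lintegral_enorm_semiclassicalFourier_lt_top {ħ : ℝ} (hħ : 0 < ħ) {n : ℕ}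
    (g : 𝓢(Euc n, ℂ)) : ∫⁻ ξ, ‖semiclassicalFourier ħ g ξ‖ₑ < ⊤ := by
  have hi : Integrable (FourierTransform.fourier (g : Euc n → ℂ)) := by
    rw [← SchwartzMap.fourier_coe]
    exact SchwartzMap.integrable _
  have hc : Continuous (FourierTransform.fourier (g : Euc n → ℂ)) := by
    rw [← SchwartzMap.fourier_coe]
    exact SchwartzMap.continuous _
  simp_rw [semiclassicalFourier_eq hħ, enorm_mul]
  rw [lintegral_const_mul' _ _ enorm_ne_top,
    lintegral_comp_inv_smul (by positivity) hc.enorm.measurable]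
  exact ENNReal.mul_lt_top enorm_lt_top (ENNReal.mul_lt_top ENNReal.ofReal_lt_top hi.2)

theorem gaussianExponent_joinEuc (ħ : ℝ) (q : ℕ → ℝ) {k m : ℕ} (p : Euc k × Euc m) :
    gaussianExponent ħ q (k + m) (joinEuc p) =
      gaussianExponent ħ q k p.1 + gaussianExponent ħ (fun j => q (k + j)) m p.2 := by
  simp only [gaussianExponent, Fin.sum_univ_add, joinEuc_castAdd, joinEuc_natAdd, mul_add,
    Fin.val_castAdd, Fin.val_natAdd]

theorem gaussianWindow_joinEuc (ħ : ℝ) (hħ : 0 < ħ) (q : ℕ → ℝ) (hq : ∀ j, 0 < q j) {k m : ℕ}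
    (p : Euc k × Euc m) : gaussianWindow ħ hħ q hq (k + m) (joinEuc p) =
      gaussianWindow ħ hħ q hq k p.1 *
        gaussianWindow ħ hħ (fun j => q (k + j)) (fun j => hq (k + j)) m p.2 := by
  simp only [gaussianWindow_eq, gaussianExponent_joinEuc, Real.exp_add, normalization_add hħ]
  push_cast
  ring

/-- The Gaussian on `ℝ^{k+m}` is the product of the one on `ℝ^k` and the one with shifted weights.
The transform is thus taken in `a` for fixed `b`, and then in `b`. -/
theorem functionSTFT_joinEuc {ħ : ℝ} {hħ : 0 < ħ} {q : ℕ → ℝ} {hq : ∀ j, 0 < q j} {k m : ℕ}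
    (f : Euc (k + m) →ᵇ ℂ) (x ξ : Euc k × Euc m) :
    functionSTFT ħ (gaussianWindow ħ hħ q hq (k + m)) f (joinEuc x) (joinEuc ξ) =
      semiclassicalFourier ħ (fun b => functionSTFT ħ (gaussianWindow ħ hħ q hq k)
          (fun a => f (joinEuc (a, b))) x.1 ξ.1 * (starRingEnd ℂ)
        (gaussianWindow ħ hħ (fun j => q (k + j)) (fun j => hq (k + j)) m (b - x.2))) ξ.2 := by
  rw [functionSTFT, semiclassicalFourier_joinEuc hħ (integrable_mul_window _ f _)]
  congr 1 with b
  rw [functionSTFT, ← semiclassicalFourier_mul_const]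
  congr 1 with a
  rw [joinEuc_sub, gaussianWindow_joinEuc, map_mul, mul_assoc]
  rfl

theorem lintegral_joinEuc {k m : ℕ} {F : Euc (k + m) → ℝ≥0∞} (hF : Measurable F) :
    ∫⁻ ξ, F ξ = ∫⁻ a : Euc k, ∫⁻ b : Euc m, F (joinEuc (a, b)) := by
  rw [← measurePreserving_joinEuc.lintegral_comp hF, Measure.volume_eq_prod]
  exact lintegral_prod _ (hF.comp continuous_joinEuc.measurable).aemeasurable

/-- With the bound `norm_functionSTFT_slice_le`, this allows Fourier inversion in `b` at a chosen
point, after multiplication by the window in `b`. -/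
theorem continuous_functionSTFT_slice {ħ : ℝ} (hħ : 0 < ħ) {k m : ℕ} (g : 𝓢(Euc k, ℂ))
    (f : Euc (k + m) →ᵇ ℂ) (x ξ : Euc k) :
    Continuous fun b : Euc m => functionSTFT ħ g (fun a => f (joinEuc (a, b))) x ξ := by
  have hslice : ∀ b : Euc m, Continuous fun a : Euc k => f (joinEuc (a, b)) := fun b =>
    f.continuous.comp (continuous_joinEuc.comp (by fun_prop))
  have hw := integrable_mul_conj_modulationFactor hħ (integrable_window g x) ξ
  refine continuous_of_dominated
    (bound := fun a => ‖f‖ * ‖(starRingEnd ℂ) (g (a - x)) *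
      (starRingEnd ℂ) (modulationFactor ħ ξ a)‖)
    (fun b => ?_) (fun b => ae_of_all _ fun a => ?_) (hw.norm.const_mul _)
    (ae_of_all _ fun a => ?_)
  · simp_rw [mul_assoc]
    exact (hslice b).aestronglyMeasurable.mul hw.aestronglyMeasurable
  · rw [mul_assoc, norm_mul]
    exact mul_le_mul_of_nonneg_right (f.norm_coe_le_norm _) (norm_nonneg _)
  · exact ((f.continuous.comp (continuous_joinEuc.comp (by fun_prop))).mul
      continuous_const).mul continuous_const

theorem norm_functionSTFT_slice_le {ħ : ℝ} (hħ : 0 < ħ) {k m : ℕ} (g : 𝓢(Euc k, ℂ))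
    (f : Euc (k + m) →ᵇ ℂ) (x ξ : Euc k) (b : Euc m) :
    ‖functionSTFT ħ g (fun a => f (joinEuc (a, b))) x ξ‖ ≤
      ‖f‖ * ∫ y, ‖(starRingEnd ℂ) (g (y - x))‖ * normalization ħ k := by
  have hc : Continuous fun a : Euc k => joinEuc (a, b) := continuous_joinEuc.comp (by fun_prop)
  refine (norm_functionSTFT_le hħ g (f.compContinuous ⟨_, hc⟩) x ξ).trans ?_
  refine mul_le_mul_of_nonneg_right (f.norm_compContinuous_le _) (integral_nonneg fun y => ?_)
  exact mul_nonneg (norm_nonneg _) (normalization_pos hħ k).le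

/-- Restriction to the first coordinates does not increase the `M^{∞,1}` norm. -/
theorem functionNorm_restrict_le {ħ : ℝ} {hħ : 0 < ħ} {q : ℕ → ℝ} {hq : ∀ j, 0 < q j} {k m : ℕ}
    (f : Euc (k + m) →ᵇ ℂ) :
    functionNorm ħ (gaussianWindow ħ hħ q hq k) (fun a => f (joinEuc (a, (0 : Euc m)))) ≤
      functionNorm ħ (gaussianWindow ħ hħ q hq (k + m)) f := by
  rw [functionNorm, functionNorm, lintegral_joinEuc (measurable_iSup_functionSTFT hħ _ f)]
  refine lintegral_mono fun ξ => iSup_le fun x => ?_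
  set g := gaussianWindow ħ hħ q hq k
  set g' := gaussianWindow ħ hħ (fun j => q (k + j)) (fun j => hq (k + j)) m with hg'
  have hc : Continuous fun b : Euc m =>
      functionSTFT ħ g (fun a => f (joinEuc (a, b))) x ξ * (starRingEnd ℂ) (g' (b - 0)) :=
    (continuous_functionSTFT_slice hħ g f x ξ).mul
      (Complex.continuous_conj.comp (g'.continuous.comp (continuous_sub_right 0)))
  have hi := (integrable_window g' 0).bdd_mul
    (continuous_functionSTFT_slice hħ g f x ξ).aestronglyMeasurable
    (ae_of_all _ (norm_functionSTFT_slice_le hħ g f x ξ))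
  -- Inversion in the removed variables at `b = 0`. The factor `g' 0` equals the inversion constant,
  -- so the bound has constant 1 whatever `m` is.
  have h := enorm_le_lintegral_semiclassicalFourier hħ hi (y := 0) hc.continuousAt
  rw [sub_self, hg', conj_gaussianWindow, gaussianWindow_zero, enorm_mul, enorm_normalization hħ,
    mul_comm, ENNReal.mul_le_mul_iff_right
      (ENNReal.ofReal_pos.2 (normalization_pos hħ m)).ne' ENNReal.ofReal_ne_top] at h
  refine h.trans (lintegral_mono fun ξ' => ?_)
  have e := functionSTFT_joinEuc (hħ := hħ) (hq := hq) f (x, 0) (ξ, ξ')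
  rw [← e]
  exact le_iSup (fun x => ‖functionSTFT ħ (gaussianWindow ħ hħ q hq (k + m)) f x
    (joinEuc (ξ, ξ'))‖ₑ) (joinEuc (x, 0))

/-- Extension by functions that do not depend on the last coordinates is bounded in the `M^{∞,1}`
norm. -/
theorem functionNorm_extend_le {ħ : ℝ} {hħ : 0 < ħ} {q : ℕ → ℝ} {hq : ∀ j, 0 < q j} {k m : ℕ}
    (f : Euc k →ᵇ ℂ) (F : Euc (k + m) →ᵇ ℂ) (hF : ∀ p, F (joinEuc p) = f p.1) :
    functionNorm ħ (gaussianWindow ħ hħ q hq (k + m)) F ≤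
      functionNorm ħ (gaussianWindow ħ hħ q hq k) f *
        ∫⁻ ξ, ‖semiclassicalFourier ħ
          (gaussianWindow ħ hħ (fun j => q (k + j)) (fun j => hq (k + j)) m) ξ‖ₑ := by
  set g' := gaussianWindow ħ hħ (fun j => q (k + j)) (fun j => hq (k + j)) m with hg'
  have hm : Measurable fun ξ => ‖semiclassicalFourier ħ g' ξ‖ₑ :=
    (continuous_semiclassicalFourier hħ g'.integrable).enorm.measurable
  rw [functionNorm, functionNorm, lintegral_joinEuc (measurable_iSup_functionSTFT hħ _ F),
    ← lintegral_mul_const _ (measurable_iSup_functionSTFT hħ _ f)]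
  refine lintegral_mono fun ξ => ?_
  rw [← lintegral_const_mul _ hm]
  refine lintegral_mono fun ξ' => iSup_le fun z => ?_
  obtain ⟨x, rfl⟩ := joinEuc_surjective z
  rw [functionSTFT_joinEuc F x (ξ, ξ')]
  -- The slices no longer depend on `b`, so the inner transform comes out as a constant. What
  -- remains is the transform of a translate of `g'`, whose modulus does not depend on the
  -- translation.
  simp only [hF]
  rw [semiclassicalFourier_const_mul, enorm_mul]
  refine mul_le_mul' (le_iSup (fun x => ‖functionSTFT ħ _ f x ξ‖ₑ) x.1) (le_of_eq ?_)
  rw [← ofReal_norm, ← ofReal_norm]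
  simp only [conj_gaussianWindow]
  rw [norm_semiclassicalFourier_comp_sub (fun y => g' y)]

/-! ### The norm on the Sjöstrand class -/

section Sjostrand

variable {ħ : ℝ} {hħ : 0 < ħ} {q : ℕ → ℝ} {hq : ∀ j, 0 < q j}

theorem sjostrandNorm_sub_le {n : ℕ} {f₁ f₂ f₃ : Euc n → ℂ}
    (h₁ : f₁ ∈ Sjostrand ħ (gaussianWindow ħ hħ q hq n))
    (h₂ : f₂ ∈ Sjostrand ħ (gaussianWindow ħ hħ q hq n))
    (h₃ : f₃ ∈ Sjostrand ħ (gaussianWindow ħ hħ q hq n)) :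
    sjostrandNorm ħ (gaussianWindow ħ hħ q hq n) (f₁ - f₃) ≤
      sjostrandNorm ħ (gaussianWindow ħ hħ q hq n) (f₁ - f₂) +
        sjostrandNorm ħ (gaussianWindow ħ hħ q hq n) (f₂ - f₃) := by
  obtain ⟨F₁, rfl, -⟩ := exists_boundedContinuousFunction_of_mem_sjostrand h₁
  obtain ⟨F₂, rfl, -⟩ := exists_boundedContinuousFunction_of_mem_sjostrand h₂
  obtain ⟨F₃, rfl, -⟩ := exists_boundedContinuousFunction_of_mem_sjostrand h₃
  simp only [← BoundedContinuousFunction.coe_sub, sjostrandNorm_coe]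
  exact functionNorm_sub_le hħ _ F₁ F₂ F₃

theorem sjostrandNorm_sub_comm {n : ℕ} {f₁ f₂ : Euc n → ℂ}
    (h₁ : f₁ ∈ Sjostrand ħ (gaussianWindow ħ hħ q hq n))
    (h₂ : f₂ ∈ Sjostrand ħ (gaussianWindow ħ hħ q hq n)) :
    sjostrandNorm ħ (gaussianWindow ħ hħ q hq n) (f₁ - f₂) =
      sjostrandNorm ħ (gaussianWindow ħ hħ q hq n) (f₂ - f₁) := by
  obtain ⟨F₁, rfl, -⟩ := exists_boundedContinuousFunction_of_mem_sjostrand h₁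
  obtain ⟨F₂, rfl, -⟩ := exists_boundedContinuousFunction_of_mem_sjostrand h₂
  simp only [← BoundedContinuousFunction.coe_sub, sjostrandNorm_coe]
  exact functionNorm_sub_comm ħ _ F₁ F₂

theorem eq_of_sjostrandNorm_sub_eq_zero {n : ℕ} {f₁ f₂ : Euc n → ℂ}
    (h₁ : f₁ ∈ Sjostrand ħ (gaussianWindow ħ hħ q hq n))
    (h₂ : f₂ ∈ Sjostrand ħ (gaussianWindow ħ hħ q hq n))
    (h : sjostrandNorm ħ (gaussianWindow ħ hħ q hq n) (f₁ - f₂) = 0) : f₁ = f₂ := by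
  obtain ⟨F₁, rfl, -⟩ := exists_boundedContinuousFunction_of_mem_sjostrand h₁
  obtain ⟨F₂, rfl, -⟩ := exists_boundedContinuousFunction_of_mem_sjostrand h₂
  rw [← BoundedContinuousFunction.coe_sub, sjostrandNorm_coe] at h
  funext y
  have h' := enorm_le_functionNorm (hħ := hħ) (hq := hq) (F₁ - F₂).continuous (integrable_mul_window _ (F₁ - F₂)) y
  rw [h, nonpos_iff_eq_zero, enorm_eq_zero] at h'
  exact sub_eq_zero.1 h'

theorem exists_tendsto_sjostrandNorm {n : ℕ} {s : ℕ → Euc n → ℂ}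
    (hmem : ∀ i, s i ∈ Sjostrand ħ (gaussianWindow ħ hħ q hq n))
    (hs : ∀ ε : ℝ≥0∞, 0 < ε → ∃ N, ∀ i ≥ N, ∀ j ≥ N,
      sjostrandNorm ħ (gaussianWindow ħ hħ q hq n) (s i - s j) < ε) :
    ∃ F ∈ Sjostrand ħ (gaussianWindow ħ hħ q hq n),
      Tendsto (fun i => sjostrandNorm ħ (gaussianWindow ħ hħ q hq n) (s i - F)) atTop (𝓝 0) := by
  choose S hS hfin using fun i => exists_boundedContinuousFunction_of_mem_sjostrand (hmem i)
  obtain rfl : (fun i => ⇑(S i)) = s := funext hS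
  simp only [← BoundedContinuousFunction.coe_sub, sjostrandNorm_coe] at hs
  obtain ⟨F, hF, hlim⟩ := exists_tendsto_functionNorm hfin hs
  refine ⟨F, coe_mem_sjostrand hF, ?_⟩
  simpa only [← BoundedContinuousFunction.coe_sub, sjostrandNorm_coe] using hlim

/-! ### Restriction of cylinder functions -/

theorem continuous_coordProj_zeroPad (n k : ℕ) :
    Continuous fun x : Euc k => coordProj n (zeroPad k x) := by
  refine (PiLp.continuous_toLp 2 _).comp (continuous_pi fun j => ?_)
  unfold zeroPad
  split_ifs with hj
  · exact (EuclideanSpace.proj (𝕜 := ℝ) (⟨j, hj⟩ : Fin k)).continuous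
  · exact continuous_const

/-- `coordProj n ∘ zeroPad k` is a projection if `n ≤ k` and a padding by zeros if `k ≤ n`; this
lemma and `coordProj_zeroPad_eq_joinEuc` are these two cases. -/
theorem coordProj_zeroPad_joinEuc {n m : ℕ} (p : Euc n × Euc m) :
    coordProj n (zeroPad (n + m) (joinEuc p)) = p.1 := by
  ext i
  have hi : (i : ℕ) < n + m := by omega
  rw [← joinEuc_castAdd p i]
  simp only [coordProj, zeroPad, dif_pos hi]
  rfl

theorem coordProj_zeroPad_eq_joinEuc {k m : ℕ} (a : Euc k) :
    coordProj (k + m) (zeroPad k a) = joinEuc (a, (0 : Euc m)) := by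
  ext i
  refine Fin.addCases (fun i => ?_) (fun i => ?_) i
  · rw [joinEuc_castAdd]
    simp [coordProj, zeroPad]
  · rw [joinEuc_natAdd]
    simp [coordProj, zeroPad]

/-- The restriction to `ℝ^k` of a cylinder function over `ℝⁿ`, as a bounded continuous function. -/
def restrictBCF (n k : ℕ) (f : Euc n →ᵇ ℂ) : Euc k →ᵇ ℂ :=
  f.compContinuous ⟨_, continuous_coordProj_zeroPad n k⟩

theorem coe_restrictBCF (n k : ℕ) (f : Euc n →ᵇ ℂ) :
    ⇑(restrictBCF n k f) = cylRestrict k (cylExtend n f) :=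
  rfl

variable (ħ hħ q hq) in
theorem exists_functionNorm_restrictBCF_le (k : ℕ) :
    ∃ C : ℝ≥0∞, C ≠ 0 ∧ C ≠ ⊤ ∧ ∀ (n : ℕ) (f : Euc n →ᵇ ℂ),
      functionNorm ħ (gaussianWindow ħ hħ q hq k) (restrictBCF n k f) ≤
        functionNorm ħ (gaussianWindow ħ hħ q hq n) f * C := by
  set I : ℕ → ℕ → ℝ≥0∞ := fun n m => ∫⁻ ξ, ‖semiclassicalFourier ħ
    (gaussianWindow ħ hħ (fun j => q (n + j)) (fun j => hq (n + j)) m) ξ‖ₑ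
  -- The `1` serves all `n ≥ k` and makes the constant nonzero; the sum dominates the extension
  -- factors for `n ≤ k`. Only finiteness of these factors matters.
  refine ⟨1 + ∑ n ∈ Finset.range (k + 1), I n (k - n), by simp, ?_, fun n f => ?_⟩
  · exact ENNReal.add_ne_top.2 ⟨ENNReal.one_ne_top, ENNReal.sum_ne_top.2 fun n _ =>
      (lintegral_enorm_semiclassicalFourier_lt_top hħ _).ne⟩
  rcases le_total k n with h | h
  · obtain ⟨m, rfl⟩ := Nat.exists_eq_add_of_le h
    have e : ⇑(restrictBCF (k + m) k f) = fun a => f (joinEuc (a, (0 : Euc m))) :=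
      funext fun a => congrArg f (coordProj_zeroPad_eq_joinEuc a)
    rw [e]
    exact (functionNorm_restrict_le f).trans (le_mul_of_one_le_right' le_self_add)
  · have hle : I n (k - n) ≤ 1 + ∑ n ∈ Finset.range (k + 1), I n (k - n) :=
      (Finset.single_le_sum (f := fun n => I n (k - n)) (fun _ _ => zero_le)
        (Finset.mem_range.2 (Nat.lt_succ_of_le h))).trans
        le_add_self
    refine le_trans ?_ (mul_le_mul_right hle _)
    obtain ⟨m, rfl⟩ := Nat.exists_eq_add_of_le h
    rw [Nat.add_sub_cancel_left]
    exact functionNorm_extend_le f (restrictBCF n (n + m) f) fun p => congrArg f (coordProj_zeroPad_joinEuc p)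

theorem cylRestrict_mem_sjostrand {f : (ℕ → ℝ) → ℂ} (hf : f ∈ cylinderFunctions ħ hħ q hq)
    (k : ℕ) : cylRestrict k f ∈ Sjostrand ħ (gaussianWindow ħ hħ q hq k) := by
  obtain ⟨n, h, hh, rfl⟩ := Set.mem_iUnion.1 hf
  obtain ⟨F, rfl, hF⟩ := exists_boundedContinuousFunction_of_mem_sjostrand hh
  obtain ⟨C, -, hC, hle⟩ := exists_functionNorm_restrictBCF_le ħ hħ q hq k
  rw [← coe_restrictBCF]
  exact coe_mem_sjostrand ((hle n F).trans_lt (ENNReal.mul_lt_top hF hC.lt_top))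

-- The bound holds for every representation of `f`, hence for the infimum `cylNorm`. If `f` has
-- none, the right side is `∞` because `C ≠ 0`; so differences of cylinder functions need not be
-- shown to be cylinder functions.
variable (ħ hħ q hq) in
theorem exists_sjostrandNorm_cylRestrict_le (k : ℕ) :
    ∃ C : ℝ≥0∞, C ≠ 0 ∧ C ≠ ⊤ ∧ ∀ f : (ℕ → ℝ) → ℂ,
      sjostrandNorm ħ (gaussianWindow ħ hħ q hq k) (cylRestrict k f) ≤
        cylNorm ħ hħ q hq f * C := by
  obtain ⟨C, hC0, hC, hle⟩ := exists_functionNorm_restrictBCF_le ħ hħ q hq k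
  refine ⟨C, hC0, hC, fun f => ?_⟩
  rw [← ENNReal.div_le_iff hC0 hC]
  refine le_iInf fun n => le_iInf₂ fun h hh => ?_
  obtain ⟨hh, rfl⟩ := hh
  obtain ⟨F, rfl, -⟩ := exists_boundedContinuousFunction_of_mem_sjostrand hh
  rw [ENNReal.div_le_iff hC0 hC, ← coe_restrictBCF, sjostrandNorm_coe, sjostrandNorm_coe]
  exact hle n F

theorem CylCauchySeq.cauchy_cylRestrict (s : CylCauchySeq ħ hħ q hq) (k : ℕ) (ε : ℝ≥0∞)
    (hε : 0 < ε) : ∃ N, ∀ i ≥ N, ∀ j ≥ N, sjostrandNorm ħ (gaussianWindow ħ hħ q hq k)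
      (cylRestrict k (s.seq i) - cylRestrict k (s.seq j)) < ε := by
  obtain ⟨C, hC0, hC, hle⟩ := exists_sjostrandNorm_cylRestrict_le ħ hħ q hq k
  obtain ⟨N, hN⟩ := s.cauchy (ε / C) (ENNReal.div_pos hε.ne' hC)
  refine ⟨N, fun i hi j hj => (hle (s.seq i - s.seq j)).trans_lt ?_⟩
  exact (ENNReal.lt_div_iff_mul_lt (Or.inl hC0) (Or.inl hC)).1 (hN i hi j hj)

/-- Equality in a `Quot` gives only a chain in the generated equivalence relation. The conclusion,
rather than `Equivalent`, is carried along the chain, because the triangle inequality is available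
on `ℝ^k`. -/
theorem CylCauchySeq.tendsto_cylRestrict_sub {s t : CylCauchySeq ħ hħ q hq}
    (h : (Quot.mk _ s : CylClosure ħ hħ q hq) = Quot.mk _ t) (k : ℕ) :
    Tendsto (fun i => sjostrandNorm ħ (gaussianWindow ħ hħ q hq k)
      (cylRestrict k (s.seq i) - cylRestrict k (t.seq i))) atTop (𝓝 0) := by
  have hmem (s : CylCauchySeq ħ hħ q hq) (i : ℕ) := cylRestrict_mem_sjostrand (s.mem i) k
  have hst := Quot.eqvGen_exact h
  clear h
  induction hst with
  | rel s t hst =>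
    obtain ⟨C, -, hC, hle⟩ := exists_sjostrandNorm_cylRestrict_le ħ hħ q hq k
    have hlim := ENNReal.Tendsto.mul_const (b := C) hst (Or.inr hC)
    rw [zero_mul] at hlim
    exact tendsto_of_tendsto_of_tendsto_of_le_of_le tendsto_const_nhds hlim
      (fun _ => zero_le) fun i => hle (s.seq i - t.seq i)
  | refl s =>
    have h0 := sjostrandNorm_coe ħ (gaussianWindow ħ hħ q hq k) 0
    have h1 : functionNorm ħ (gaussianWindow ħ hħ q hq k) (0 : Euc k → ℂ) = 0 := by
      simp [functionNorm, functionSTFT, semiclassicalFourier]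
    rw [BoundedContinuousFunction.coe_zero, h1] at h0
    simp only [sub_self, h0, tendsto_const_nhds]
  | symm s t _ ih => simpa only [sjostrandNorm_sub_comm (hmem t _) (hmem s _)] using ih
  | trans s t u _ _ ih₁ ih₂ =>
    have hlim := ih₁.add ih₂
    rw [add_zero] at hlim
    exact tendsto_of_tendsto_of_tendsto_of_le_of_le tendsto_const_nhds hlim
      (fun _ => zero_le) fun i => sjostrandNorm_sub_le (hmem s i) (hmem t i) (hmem u i)

end Sjostrand

end

theorem theorem5p4 (ħ : ℝ) (hħ : 0 < ħ) (q : ℕ → ℝ) (hq : ∀ j, 0 < q j)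
    (f : CylClosure ħ hħ q hq) (k : ℕ) :
    (∀ s : CylCauchySeq ħ hħ q hq, s.IsRepresentative f →
      (∀ n, cylRestrict k (s.seq n) ∈ Sjostrand ħ (gaussianWindow ħ hħ q hq k)) ∧
      ∀ ε : ENNReal, 0 < ε → ∃ N, ∀ m ≥ N, ∀ n ≥ N,
        sjostrandNorm ħ (gaussianWindow ħ hħ q hq k)
          (cylRestrict k (s.seq m) - cylRestrict k (s.seq n)) < ε) ∧
    ∃! F : EuclideanSpace ℝ (Fin k) → ℂ,
      F ∈ Sjostrand ħ (gaussianWindow ħ hħ q hq k) ∧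
      ∀ s : CylCauchySeq ħ hħ q hq, s.IsRepresentative f →
        Tendsto (fun n => sjostrandNorm ħ (gaussianWindow ħ hħ q hq k)
          (cylRestrict k (s.seq n) - F)) atTop (𝓝 0) := by
  have hmem (s : CylCauchySeq ħ hħ q hq) (n : ℕ) := cylRestrict_mem_sjostrand (s.mem n) k
  refine ⟨fun s _ => ⟨hmem s, s.cauchy_cylRestrict k⟩, ?_⟩
  -- The limit is built from one representative `t`, with which every other representative is then
  -- compared.
  obtain ⟨t, rfl⟩ := Quot.exists_rep f
  obtain ⟨F, hF, hlim⟩ := exists_tendsto_sjostrandNorm (hmem t) (t.cauchy_cylRestrict k)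
  refine ⟨F, ⟨hF, fun s hs => ?_⟩, fun G hG => ?_⟩
  · have h := (CylCauchySeq.tendsto_cylRestrict_sub hs k).add hlim
    rw [add_zero] at h
    exact tendsto_of_tendsto_of_tendsto_of_le_of_le tendsto_const_nhds h
      (fun _ => zero_le) fun n => sjostrandNorm_sub_le (hmem s n) (hmem t n) hF
  · have h := (hG.2 t rfl).add hlim
    rw [add_zero] at h
    -- The fixed number `‖G - F‖` is at most `‖t_n - G‖ + ‖t_n - F‖` (restrictions understood),
    -- which tends to `0`.
    refine eq_of_sjostrandNorm_sub_eq_zero hG.1 hF (nonpos_iff_eq_zero.1 (ge_of_tendsto' h ?_))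
    intro n
    have h' := sjostrandNorm_sub_le hG.1 (hmem t n) hF
    rwa [sjostrandNorm_sub_comm hG.1 (hmem t n)] at h'
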